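/- There is an absolute constant $K>0$ such that the following holds for every integer $n\ge 1$. Write $[n]=\{1,\dots,n\}$ and $\overline{X}=[n]\setminus X$ for $X\subseteq[n]$. If $\mathcal{F}$ is a family of subsets of $[n]$ with $|\mathcal{F}|\ge Kn^3$, then there are three sets $A,B,C\in\mathcal{F}$ such that all seven inner regions of their Venn diagram are non-empty, that is, each of the sets $$A\cap B\cap C,\quad A\cap B\cap\overline{C},\quad A\cap\overline{B}\cap C,\quad \overline{A}\cap B\cap C,\quad A\cap\overline{B}\cap\overline{C},\quad \overline{A}\cap B\cap\overline{C},\quad \overline{A}\cap\overline{B}\cap C$$ is non-empty. (The outermost region $\overline{A}\cap\overline{B}\cap\overline{C}$ may be empty.) -/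

import Mathlib

/-- The set `A` itself (for `true`) or its complement in the ground set `[n]` (for `false`). -/
def vennSide {n : ℕ} (A : Finset (Fin n)) : Bool → Finset (Fin n)
  | true => A
  | false => Aᶜ

/-- The eight regions of the 3-Venn diagram of `A, B, C`, indexed by three Booleans that say
inside which of the three sets the region lies. -/
def vennRegion {n : ℕ} (A B C : Finset (Fin n)) (a b c : Bool) : Finset (Fin n) :=
  vennSide A a ∩ vennSide B b ∩ vennSide C c

/-- All seven inner regions of the 3-Venn diagram of `A, B, C`, that is, all regions other than
the outermost one `Aᶜ ∩ Bᶜ ∩ Cᶜ`, are non-empty. Nothing is said of the outermost region. -/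
def InnerRegionsFilled {n : ℕ} (A B C : Finset (Fin n)) : Prop :=
  ∀ a b c : Bool, (a, b, c) ≠ (false, false, false) → (vennRegion A B C a b c).Nonempty

/-! Bound the size of families in which no triple fills more than `k` inner regions, lowering `k`
one at a time. Deleting a point `z` splits a family into its trace and its double link, with sizes
adding up. The trace keeps the bound `k`; the link satisfies `k - 1`, because each of three link
members can be taken with or without `z`, so that `z` fills any one missing region. Hence a
quadratic bound for `k = 5` gives a cubic one for `k = 6` by induction on the ground set.

For `k = 5`, the link at each point has bound 4, and all but linearly many of its members have forks
(`RegionBound.exists_forked_subfamily`). In a family of size just above the quadratic bound, the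
induction hypothesis makes every link large, so there are more pairs (point, forked link member)
than sets. Some set then has forks at two different points, which forces a triple with six regions
(`RegionBound.false_of_hasForks_of_hasForks`).

Forks for `k = 4`: points with small links are traced away, and forks lift back. Once all links are
large, they are laminar, being of bound 3. An extremal choice of nested or disjoint link members
then yields a forked pair `{w, q}`. -/

/-! ### Traces, double links and laminar families -/

section Families

variable {α : Type*} [DecidableEq α]

/-- The sets `A` avoiding `z` such that both `A` and `A ∪ {z}` belong to `F`. -/
def doubleLink (F : Finset (Finset α)) (z : α) : Finset (Finset α) :=
  F.filter fun A => z ∉ A ∧ insert z A ∈ F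

/-- The trace of `F` on the complement of `{z}`. -/
def traceErase (F : Finset (Finset α)) (z : α) : Finset (Finset α) :=
  F.image fun A => A.erase z

lemma mem_doubleLink {F : Finset (Finset α)} {z : α} {A : Finset α} :
    A ∈ doubleLink F z ↔ A ∈ F ∧ z ∉ A ∧ insert z A ∈ F := by
  simp [doubleLink]

lemma card_traceErase_add_card_doubleLink (F : Finset (Finset α)) (z : α) :
    (traceErase F z).card + (doubleLink F z).card = F.card := by
  have h1 : traceErase F z = F.memberSubfamily z ∪ F.nonMemberSubfamily z := by
    ext A
    simp only [traceErase, Finset.mem_image, Finset.mem_union, Finset.mem_memberSubfamily,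
      Finset.mem_nonMemberSubfamily]
    constructor
    · rintro ⟨B, hB, rfl⟩
      by_cases hz : z ∈ B
      · left
        simp [Finset.insert_erase hz, hB]
      · right
        simp [hB, hz]
    · rintro (⟨h1, h2⟩ | ⟨h1, h2⟩)
      · exact ⟨_, h1, Finset.erase_insert h2⟩
      · exact ⟨_, h1, Finset.erase_eq_of_notMem h2⟩
  have h2 : doubleLink F z = F.memberSubfamily z ∩ F.nonMemberSubfamily z := by
    ext A
    simp only [mem_doubleLink, Finset.mem_inter, Finset.mem_memberSubfamily,
      Finset.mem_nonMemberSubfamily]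
    tauto
  rw [h1, h2, Finset.card_union_add_card_inter,
    Finset.card_memberSubfamily_add_card_nonMemberSubfamily]

lemma mem_traceErase {F : Finset (Finset α)} {z : α} {A : Finset α} (h : A ∈ traceErase F z) :
    z ∉ A ∧ (A ∈ F ∨ insert z A ∈ F) := by
  obtain ⟨B, hB, rfl⟩ := Finset.mem_image.1 h
  refine ⟨Finset.notMem_erase _ _, ?_⟩
  by_cases hz : z ∈ B
  · right
    rwa [Finset.insert_erase hz]
  · left
    rwa [Finset.erase_eq_of_notMem hz]

/-- Any two members are nested or disjoint. -/
def IsLaminar (F : Finset (Finset α)) : Prop :=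
  ∀ A ∈ F, ∀ B ∈ F, A ⊆ B ∨ B ⊆ A ∨ Disjoint A B

/-- Without chains of three, the maximal members and the non-maximal members are both antichains,
and an antichain in a laminar family is pairwise disjoint. The larger class serves. -/
lemma IsLaminar.exists_pairwiseDisjoint {Q : Finset (Finset α)} (hQ : IsLaminar Q)
    (h3 : ∀ A ∈ Q, ∀ B ∈ Q, ∀ C ∈ Q, A ⊂ B → B ⊂ C → False) :
    ∃ R ⊆ Q, Q.card ≤ 2 * R.card ∧ ∀ A ∈ R, ∀ B ∈ R, A ≠ B → Disjoint A B := by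
  have hcard := Finset.card_filter_add_card_filter_not (s := Q) (fun A => ∃ B ∈ Q, A ⊂ B)
  rcases le_total (Q.filter fun A => ∃ B ∈ Q, A ⊂ B).card
    (Q.filter fun A => ¬ ∃ B ∈ Q, A ⊂ B).card with h | h
  · refine ⟨_, Finset.filter_subset (fun A => ¬ ∃ B ∈ Q, A ⊂ B) Q, by omega, ?_⟩
    intro A hA B hB hAB
    simp only [Finset.mem_filter] at hA hB
    rcases hQ A hA.1 B hB.1 with k | k | k
    · exact absurd ⟨B, hB.1, k.ssubset_of_ne hAB⟩ hA.2
    · exact absurd ⟨A, hA.1, k.ssubset_of_ne hAB.symm⟩ hB.2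
    · exact k
  · refine ⟨_, Finset.filter_subset (fun A => ∃ B ∈ Q, A ⊂ B) Q, by omega, ?_⟩
    intro A hA B hB hAB
    simp only [Finset.mem_filter] at hA hB
    obtain ⟨hA, A', hA', hAA⟩ := hA
    obtain ⟨hB, B', hB', hBB⟩ := hB
    rcases hQ A hA B hB with k | k | k
    · exact (h3 A hA B hB B' hB' (k.ssubset_of_ne hAB) hBB).elim
    · exact (h3 B hB A hA A' hA' (k.ssubset_of_ne hAB.symm) hAA).elim
    · exact k

/-- In a laminar family without chains of three members, at most two members share a point. -/
lemma IsLaminar.card_le_two {Q : Finset (Finset α)} (hQ : IsLaminar Q)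
    (h3 : ∀ A ∈ Q, ∀ B ∈ Q, ∀ C ∈ Q, A ⊂ B → B ⊂ C → False) {a : α} (ha : ∀ A ∈ Q, a ∈ A) :
    Q.card ≤ 2 := by
  obtain ⟨R, hR, hc, hd⟩ := hQ.exists_pairwiseDisjoint h3
  have : R.card ≤ 1 := by
    rw [Finset.card_le_one]
    intro A hA B hB
    by_contra hAB
    exact Finset.disjoint_left.1 (hd A hA B hB hAB) (ha A (hR hA)) (ha B (hR hB))
  omega

end Families

/-! ### Counting filled regions under trace and link -/

section RegionCounting

variable {α : Type*} [Fintype α] [DecidableEq α]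

/-- The membership pattern of a point with respect to three sets. -/
def memPattern (A B C : Finset α) (x : α) : Bool × Bool × Bool :=
  (decide (x ∈ A), decide (x ∈ B), decide (x ∈ C))

/-- The inner patterns realised by some point, that is, the non-empty inner regions of the Venn
diagram of three sets. -/
def filledRegions (A B C : Finset α) : Finset (Bool × Bool × Bool) :=
  (Finset.univ.image (memPattern A B C)).erase (false, false, false)

/-- Every three members of `F` have at most `k` non-empty inner regions. -/
def RegionBound (k : ℕ) (F : Finset (Finset α)) : Prop :=
  ∀ A ∈ F, ∀ B ∈ F, ∀ C ∈ F, (filledRegions A B C).card ≤ k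

lemma RegionBound.mono {k : ℕ} {F G : Finset (Finset α)} (h : RegionBound k F) (hG : G ⊆ F) :
    RegionBound k G :=
  fun A hA B hB C hC => h A (hG hA) B (hG hB) C (hG hC)

lemma mem_filledRegions {A B C : Finset α} {t : Bool × Bool × Bool} :
    t ∈ filledRegions A B C ↔ t ≠ (false, false, false) ∧ ∃ x, memPattern A B C x = t := by
  simp [filledRegions]

/-- Points in pairwise different inner regions bound the number of filled regions from below. -/
lemma RegionBound.false_of_points {k : ℕ} {F : Finset (Finset α)} (h : RegionBound k F)
    {A B C : Finset α} (hA : A ∈ F) (hB : B ∈ F) (hC : C ∈ F) (l : List α)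
    (hl : k < l.length)
    (hd : (((false, false, false) : Bool × Bool × Bool) :: l.map (memPattern A B C)).Nodup) :
    False := by
  have h1 := h A hA B hB C hC
  rw [List.nodup_cons] at hd
  have h2 : (l.map (memPattern A B C)).toFinset ⊆ filledRegions A B C := by
    intro t ht
    rw [List.mem_toFinset] at ht
    rw [mem_filledRegions]
    refine ⟨fun h => hd.1 (h ▸ ht), ?_⟩
    obtain ⟨x, -, hx⟩ := List.mem_map.1 ht
    exact ⟨x, hx⟩
  have h3 := Finset.card_le_card h2
  rw [List.toFinset_card_of_nodup hd.2, List.length_map] at h3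
  omega

lemma RegionBound.trace {k : ℕ} {F : Finset (Finset α)} (h : RegionBound k F) (z : α) :
    RegionBound k (traceErase F z) := by
  intro A' hA' B' hB' C' hC'
  obtain ⟨A, hA, rfl⟩ := Finset.mem_image.1 hA'
  obtain ⟨B, hB, rfl⟩ := Finset.mem_image.1 hB'
  obtain ⟨C, hC, rfl⟩ := Finset.mem_image.1 hC'
  refine (Finset.card_le_card ?_).trans (h A hA B hB C hC)
  intro t ht
  rw [mem_filledRegions] at ht ⊢
  obtain ⟨h1, x, rfl⟩ := ht
  refine ⟨h1, x, ?_⟩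
  have hx : x ≠ z := by
    rintro rfl
    simp [memPattern] at h1
  simp [memPattern, hx]

/-- With `k < 6` some inner region of a link triple is empty. Adding `z` to the appropriate members
puts `z` there and keeps the regions already filled, as these do not involve `z`. -/
lemma RegionBound.link {k : ℕ} (hk : k < 6) {F : Finset (Finset α)}
    (h : RegionBound (k + 1) F) (z : α) : RegionBound k (doubleLink F z) := by
  intro A hA B hB C hC
  rw [mem_doubleLink] at hA hB hC
  by_contra! hcon
  have h7 := h A hA.1 B hB.1 C hC.1
  obtain ⟨t, ht0, ht⟩ : ∃ t, t ≠ (false, false, false) ∧ t ∉ filledRegions A B C := by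
    by_contra! hall
    have : Finset.univ.erase (false, false, false) ⊆ filledRegions A B C := by
      intro t ht
      exact hall t (Finset.ne_of_mem_erase ht)
    have := Finset.card_le_card this
    rw [Finset.card_erase_of_mem (Finset.mem_univ _)] at this
    simp at this
    omega
  have key : ∀ (b : Bool) (X : Finset α), X ∈ F ∧ z ∉ X ∧ insert z X ∈ F →
      ∃ Y ∈ F, (decide (z ∈ Y) = b) ∧ ∀ x, x ≠ z → (x ∈ Y ↔ x ∈ X) := by
    intro b X hX
    cases b
    · exact ⟨X, hX.1, by simpa using hX.2.1, fun x _ => Iff.rfl⟩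
    · exact ⟨insert z X, hX.2.2, by simp, fun x hx => by simp [hx]⟩
  obtain ⟨A', hA', hzA, hxA⟩ := key t.1 A hA
  obtain ⟨B', hB', hzB, hxB⟩ := key t.2.1 B hB
  obtain ⟨C', hC', hzC, hxC⟩ := key t.2.2 C hC
  have hsub : insert t (filledRegions A B C) ⊆ filledRegions A' B' C' := by
    intro s hs
    rw [mem_filledRegions]
    rcases Finset.mem_insert.1 hs with rfl | hs
    · exact ⟨ht0, z, by simp only [memPattern, hzA, hzB, hzC]⟩
    · rw [mem_filledRegions] at hs
      obtain ⟨h1, x, rfl⟩ := hs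
      refine ⟨h1, x, ?_⟩
      have hx : x ≠ z := by
        rintro rfl
        simp [memPattern, hA.2.1, hB.2.1, hC.2.1] at h1
      simp [memPattern, hxA x hx, hxB x hx, hxC x hx]
  have h1 := Finset.card_le_card hsub
  rw [Finset.card_insert_of_notMem ht] at h1
  have h2 := h A' hA' B' hB' C' hC'
  omega

/-- If `A` and `B` cross, points `u`, `v`, `t` already fill three regions. A fourth would appear if
`C` separated a point from its representative or left `A ∪ B`, so three bits determine `C` and at
most 8 sets are possible. -/
lemma RegionBound.isLaminar {F : Finset (Finset α)} (h : RegionBound 3 F) (hF : 8 < F.card) :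
    IsLaminar F := by
  intro A hA B hB
  by_contra! hcon
  obtain ⟨h1, h2, h3⟩ := hcon
  obtain ⟨v, hvA, hvB⟩ := Finset.not_subset.1 h1
  obtain ⟨t, htB, htA⟩ := Finset.not_subset.1 h2
  obtain ⟨u, huA, huB⟩ := Finset.not_disjoint_iff.1 h3
  have hinj : Set.InjOn (fun C => (decide (u ∈ C), decide (v ∈ C), decide (t ∈ C)))
      (F : Set (Finset α)) := by
    have key : ∀ C ∈ F, ∀ x, x ∈ C ↔ (x ∈ A ∧ x ∈ B ∧ u ∈ C) ∨ (x ∈ A ∧ x ∉ B ∧ v ∈ C) ∨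
        (x ∉ A ∧ x ∈ B ∧ t ∈ C) := by
      intro C hC x
      have h4 := h.false_of_points hA hB hC [u, v, t, x] (by simp)
      by_contra hx
      apply h4
      by_cases k1 : u ∈ C <;> by_cases k2 : v ∈ C <;> by_cases k3 : t ∈ C <;>
      by_cases k4 : x ∈ C <;> by_cases k5 : x ∈ A <;> by_cases k6 : x ∈ B <;>
      simp_all [memPattern]
    intro C hC C' hC' heq
    ext x
    simp only [Prod.mk.injEq, decide_eq_decide] at heq
    rw [key C hC x, key C' hC' x, heq.1, heq.2.1, heq.2.2]
  have := Finset.card_le_card_of_injOn _ (t := (Finset.univ : Finset (Bool × Bool × Bool)))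
    (fun _ _ => Finset.mem_coe.2 (Finset.mem_univ _)) hinj
  simp at this
  omega

end RegionCounting

/-! ### Forks and their lifting through a trace -/

section Forks

variable {α : Type*} [DecidableEq α]

/-- The set `D` is split into two non-empty cores, and each core is the kernel of a sunflower of
five members of `H` that meet `D` in this core only. The ten petals are non-empty and pairwise
disjoint. -/
def HasForks (H : Finset (Finset α)) (D : Finset α) : Prop :=
  ∃ (P : Bool → Finset α) (E : Bool → Fin 5 → Finset α),
    (∀ b, (P b).Nonempty) ∧ Disjoint (P true) (P false) ∧ D = P true ∪ P false ∧
    (∀ b i, E b i ∈ H ∧ D ∩ E b i = P b ∧ (E b i \ D).Nonempty) ∧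
    ∀ b i c j, (b, i) ≠ (c, j) → Disjoint (E b i \ D) (E c j \ D)

lemma HasForks.mono {H H' : Finset (Finset α)} {D : Finset α} (h : HasForks H D) (hH : H ⊆ H') :
    HasForks H' D := by
  obtain ⟨P, E, h1, h2, h3, h4, h5⟩ := h
  exact ⟨P, E, h1, h2, h3, fun b i => ⟨hH (h4 b i).1, (h4 b i).2⟩, h5⟩

/-- Core points and petal points keep their patterns in any lifts, and with two lifted petal sets
they fill four regions. A badly placed `z` would fill a fifth, so `z` either joins exactly one core
or lies in at most one petal. -/
lemma HasForks.of_traceErase [Fintype α] {H : Finset (Finset α)} (hH : RegionBound 4 H) {z : α}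
    {D : Finset α} (hD : D ∈ traceErase H z) (h : HasForks (traceErase H z) D) :
    ∃ D' ∈ H, HasForks H D' := by
  obtain ⟨P, E, h1, h2, h3, h4, h5⟩ := h
  have hzP : ∀ b, z ∉ P b := fun b hb => by
    rw [← (h4 b 0).2.1] at hb
    exact (mem_traceErase hD).1 (Finset.mem_inter.1 hb).1
  choose p hp using h1
  have h4' : ∀ b i, ∃ e, e ∈ E b i \ D := fun b i => (h4 b i).2.2
  choose e he using h4'
  have hlift : ∀ X ∈ traceErase H z, ∃ Y ∈ H, ∀ x, x ≠ z → (x ∈ Y ↔ x ∈ X) := by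
    intro X hX
    obtain ⟨Y, hY, rfl⟩ := Finset.mem_image.1 hX
    exact ⟨Y, hY, fun x hx => by simp [hx]⟩
  obtain ⟨D', hD', hDx⟩ := hlift D hD
  have hE : ∀ b i, ∃ Y ∈ H, ∀ x, x ≠ z → (x ∈ Y ↔ x ∈ E b i) := fun b i => hlift _ (h4 b i).1
  choose E' hE' hEx using hE
  have hPD : ∀ b x, x ∈ P b → x ∈ D := by
    intro b x hx
    rw [h3]
    cases b <;> simp [hx]
  have hpz : ∀ b, p b ≠ z := fun b hb => hzP b (hb ▸ hp b)
  have hpD : ∀ b, p b ∈ D' := fun b => (hDx _ (hpz b)).2 (hPD b _ (hp b))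
  have hpE : ∀ b c i, p b ∈ E' c i ↔ b = c := by
    intro b c i
    have hb := hp b
    have h6 : p b ∈ E c i ↔ p b ∈ P c := by
      rw [← (h4 c i).2.1]
      simp [hPD b _ hb]
    rw [hEx _ _ _ (hpz b), h6]
    constructor
    · intro hc
      by_contra hbc
      rw [Finset.disjoint_left] at h2
      cases b <;> cases c <;> first | exact hbc rfl | exact h2 hb hc | exact h2 hc hb
    · rintro rfl
      exact hb
  have hez : ∀ b i, e b i ≠ z := by
    intro b i hb
    have := he b i
    rw [hb, Finset.mem_sdiff] at this
    exact (mem_traceErase (h4 b i).1).1 this.1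
  have heD : ∀ b i, e b i ∉ D' := by
    intro b i hb
    rw [hDx _ (hez b i)] at hb
    exact (Finset.mem_sdiff.1 (he b i)).2 hb
  have heE : ∀ b i c j, e b i ∈ E' c j ↔ (b = c ∧ i = j) := by
    intro b i c j
    rw [hEx _ _ _ (hez b i)]
    constructor
    · intro hc
      by_contra hne
      refine Finset.disjoint_left.1 (h5 b i c j ?_) (he b i) ?_
      · simpa using hne
      · exact Finset.mem_sdiff.2 ⟨hc, (Finset.mem_sdiff.1 (he b i)).2⟩
    · rintro ⟨rfl, rfl⟩
      exact (Finset.mem_sdiff.1 (he b i)).1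
  -- If `z` is outside `D'`, two petals sharing `z` would add a region to the four filled by two
  -- core points and two petal points.
  have F1 : ∀ b i c j, (b, i) ≠ (c, j) → z ∉ D' → z ∈ E' b i → z ∉ E' c j := by
    intro b i c j hne hz hb hc
    by_cases hbc : b = c
    · subst hbc
      have hij : i ≠ j := fun h => hne (by rw [h])
      refine hH.false_of_points hD' (hE' b i) (hE' b j) [p b, p !b, z, e b i, e b j] (by simp) ?_
      simp [memPattern, hpD, hpE, heD, heE, hz, hb, hc, hij, hij.symm]
    · refine hH.false_of_points hD' (hE' b i) (hE' c j) [p b, p c, z, e b i, e c j] (by simp) ?_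
      simp [memPattern, hpD, hpE, heD, heE, hz, hb, hc, hbc, Ne.symm hbc]
  have F2 : ∀ b i j, z ∈ D' → z ∈ E' b i → z ∈ E' b j := by
    intro b i j hz hb
    by_contra hc
    have hij : i ≠ j := by
      rintro rfl
      exact hc hb
    refine hH.false_of_points hD' (hE' b i) (hE' b j) [p b, p !b, z, e b i, e b j] (by simp) ?_
    simp [memPattern, hpD, hpE, heD, heE, hz, hb, hc, hij, hij.symm]
  have F3 : ∀ i j, z ∈ D' → (z ∈ E' true i ↔ z ∉ E' false j) := by
    intro i j hz
    by_contra hcon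
    refine hH.false_of_points hD' (hE' true i) (hE' false j)
      [p true, p false, z, e true i, e false j] (by simp) ?_
    by_cases hb : z ∈ E' true i <;> by_cases hc : z ∈ E' false j <;>
      simp [memPattern, hpD, hpE, heD, heE, hz, hb, hc] at hcon ⊢
  have hDE : ∀ b i x, x ∈ D' ∩ E' b i ↔ x ∈ D' ∩ E' b 0 := by
    intro b i x
    rw [Finset.mem_inter, Finset.mem_inter]
    by_cases hx : x = z
    · subst hx
      exact and_congr_right fun hz => ⟨F2 b i 0 hz, F2 b 0 i hz⟩
    · rw [hDx x hx, hEx b i x hx, hEx b 0 x hx, ← Finset.mem_inter, ← Finset.mem_inter,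
        (h4 b i).2.1, (h4 b 0).2.1]
  refine ⟨D', hD', fun b => D' ∩ E' b 0, E', ?_, ?_, ?_, ?_, ?_⟩
  · intro b
    exact ⟨p b, by simp [hpD, hpE]⟩
  · rw [Finset.disjoint_left]
    intro x hx hy
    rw [Finset.mem_inter] at hx hy
    by_cases hxz : x = z
    · subst hxz
      exact (F3 0 0 hx.1).1 hx.2 hy.2
    · rw [hDx x hxz, hEx _ _ x hxz, ← Finset.mem_inter, (h4 _ _).2.1] at hx hy
      exact Finset.disjoint_left.1 h2 hx hy
  · ext x
    by_cases hxz : x = z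
    · subst hxz
      have := F3 0 0
      simp only [Finset.mem_union, Finset.mem_inter]
      tauto
    · rw [Finset.mem_union, Finset.mem_inter, Finset.mem_inter, hDx x hxz, hEx _ _ x hxz,
        hEx _ _ x hxz, ← Finset.mem_inter, ← Finset.mem_inter, (h4 _ _).2.1, (h4 _ _).2.1,
        ← Finset.mem_union, ← h3]
  · intro b i
    exact ⟨hE' b i, Finset.ext (hDE b i), e b i, by simp [heD, heE]⟩
  · intro b i c j hne
    rw [Finset.disjoint_left]
    intro x hx hy
    rw [Finset.mem_sdiff] at hx hy
    by_cases hxz : x = z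
    · subst hxz
      exact F1 b i c j hne hx.2 hx.1 hy.1
    · rw [hDx x hxz, hEx _ _ x hxz, ← Finset.mem_sdiff] at hx hy
      exact Finset.disjoint_left.1 (h5 b i c j hne) hx hy

end Forks

/-! ### Existence of forks when triples fill at most four regions -/

section ForkExistence

variable {α : Type*} [DecidableEq α]

/-- The free choice at `w` splits a region of two other sets that contains both `w` and `u`, at no
cost elsewhere. -/
lemma exists_separating_of_mem_doubleLink {H : Finset (Finset α)} {w u : α} {C : Finset α}
    (hC : C ∈ doubleLink H w) (hu : u ≠ w) :
    ∃ C' ∈ H, (w ∈ C' ↔ u ∉ C') ∧ ∀ x, x ≠ w → (x ∈ C' ↔ x ∈ C) := by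
  rw [mem_doubleLink] at hC
  by_cases h : u ∈ C
  · exact ⟨C, hC.1, by simp [h, hC.2.1], fun _ _ => Iff.rfl⟩
  · exact ⟨insert w C, hC.2.2, by simp [h, hu], fun x hx => by simp [hx]⟩

/-- A difference `B \ A` of members of the double link of `z` confines the double links of the
points that it contains. -/
lemma RegionBound.subset_of_mem_sdiff [Fintype α] {H : Finset (Finset α)} (hH : RegionBound 4 H)
    {z w : α} {A B C : Finset α} (hA : A ∈ doubleLink H z) (hB : B ∈ doubleLink H z)
    (hA0 : A.Nonempty) (hAB : A ⊆ B) (hc : 2 ≤ (B \ A).card) (hw : w ∈ B \ A)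
    (hC : C ∈ doubleLink H w) : C ⊆ insert z B ∧ (A ⊆ C ∨ Disjoint A C) := by
  obtain ⟨u, hu, huw⟩ := Finset.exists_mem_ne (by omega : 1 < (B \ A).card) w
  obtain ⟨C', hC', hs, hx⟩ := exists_separating_of_mem_doubleLink hC huw
  rw [mem_doubleLink] at hA hB
  rw [Finset.mem_sdiff] at hu hw
  have hwz : w ≠ z := by
    rintro rfl
    exact hB.2.1 hw.1
  have huz : u ≠ z := by
    rintro rfl
    exact hB.2.1 hu.1
  constructor
  · intro x hxC
    by_contra hxB
    rw [Finset.mem_insert, not_or] at hxB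
    have hxw : x ≠ w := by
      rintro rfl
      exact hxB.2 hw.1
    have hxA : x ∉ A := fun h => hxB.2 (hAB h)
    obtain ⟨a, ha⟩ := hA0
    refine hH.false_of_points hA.2.2 hB.1 hC' [a, w, u, x, z] (by simp) ?_
    rw [← hx x hxw] at hxC
    by_cases huC : u ∈ C' <;>
      simp [memPattern, ha, hAB ha, hw, hu, hwz, huz, hxB, hxA, hA.2.1, hB.2.1, huC, hs, hxC]
  · by_contra! hcon
    obtain ⟨a', ha', haC'⟩ := Finset.not_subset.1 hcon.1
    obtain ⟨a, ha, haC⟩ := Finset.not_disjoint_iff.1 hcon.2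
    have haw : a ≠ w := by
      rintro rfl
      exact hw.2 ha
    have haw' : a' ≠ w := by
      rintro rfl
      exact hw.2 ha'
    rw [← hx a haw] at haC
    rw [← hx a' haw'] at haC'
    refine hH.false_of_points hA.2.2 hB.1 hC' [a, a', w, u, z] (by simp) ?_
    by_cases huC : u ∈ C' <;>
      simp [memPattern, ha, ha', hAB ha, hAB ha', hw, hu, hwz, huz, hA.2.1, hB.2.1, huC, hs, haC,
        haC']

/-- Points with large double links can be found in a set `Z` that contains large disjoint
subfamilies of these links. -/
lemma RegionBound.exists_disjoint_doubleLinks [Fintype α] {H : Finset (Finset α)}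
    (hH : RegionBound 4 H) {S : Finset α} (hS : ∀ A ∈ H, A ⊆ S) (hS0 : S.Nonempty)
    (hbig : ∀ z ∈ S, 60 ≤ (doubleLink H z).card) :
    ∃ Z : Finset α, Z.Nonempty ∧ ∀ w ∈ Z, ∃ M ⊆ doubleLink H w, 22 ≤ M.card ∧
      (∀ A ∈ M, ∀ B ∈ M, A ≠ B → Disjoint A B) ∧ ∀ A ∈ M, A.Nonempty ∧ A ⊆ Z := by
  have hlam : ∀ w ∈ S, IsLaminar (doubleLink H w) := fun w hw =>
    (hH.link (by norm_num) w).isLaminar (by have := hbig w hw; omega)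
  by_cases hbox : ∃ n z A B, A ∈ doubleLink H z ∧ B ∈ doubleLink H z ∧ A.Nonempty ∧ A ⊆ B ∧
      2 ≤ (B \ A).card ∧ (B \ A).card = n
  · obtain ⟨n, ⟨z, A, B, hA, hB, hA0, hAB, hc, rfl⟩, hmin⟩ :=
      WellFounded.has_min wellFounded_lt {n | ∃ z A B, A ∈ doubleLink H z ∧ B ∈ doubleLink H z ∧
        A.Nonempty ∧ A ⊆ B ∧ 2 ≤ (B \ A).card ∧ (B \ A).card = n} hbox
    refine ⟨B \ A, Finset.card_pos.1 (by omega), fun w hw => ?_⟩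
    have hwS : w ∈ S := hS B (mem_doubleLink.1 hB).1 (Finset.mem_sdiff.1 hw).1
    obtain ⟨a, ha⟩ := hA0
    have hconf := fun C (hC : C ∈ doubleLink H w) =>
      hH.subset_of_mem_sdiff hA hB ⟨a, ha⟩ hAB hc hw hC
    -- If `X` agrees with `T` about `a` and `z` as required, confinement puts `T \ X` inside `B \
    -- A`. It misses `w`, contradicting the minimality of `B \ A`.
    have hchain : ∀ X ∈ doubleLink H w, ∀ Y ∈ doubleLink H w, ∀ T ∈ doubleLink H w,
        X.Nonempty → (a ∈ T → a ∈ X) → (z ∈ T → z ∈ X) → X ⊂ Y → Y ⊂ T → False := by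
      intro X hX Y hY T hT hX0 hXa hXz hXY hYT
      have h2 : 2 ≤ (T \ X).card := by
        rw [Finset.card_sdiff_of_subset (hXY.1.trans hYT.1)]
        have := Finset.card_lt_card hXY
        have := Finset.card_lt_card hYT
        omega
      have h3 := hmin _ ⟨w, X, T, hX, hT, hX0, hXY.1.trans hYT.1, h2, rfl⟩
      have h4 : T \ X ⊂ B \ A := by
        rw [Finset.ssubset_iff_of_subset]
        · refine ⟨w, hw, fun h => (mem_doubleLink.1 hT).2.1 (Finset.mem_sdiff.1 h).1⟩
        · intro x hx
          rw [Finset.mem_sdiff] at hx ⊢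
          have hxB := (hconf T hT).1 hx.1
          rw [Finset.mem_insert] at hxB
          refine ⟨hxB.resolve_left ?_, fun hxA => ?_⟩
          · rintro rfl
            exact hx.2 (hXz hx.1)
          · rcases (hconf T hT).2 with h | h
            · rcases (hconf X hX).2 with h' | h'
              · exact hx.2 (h' hxA)
              · exact Finset.disjoint_left.1 h' ha (hXa (h ha))
            · exact Finset.disjoint_left.1 h hxA hx.1
      exact h3 (Finset.card_lt_card h4)
    have hlamf : ∀ (p : Finset α → Prop) [DecidablePred p], IsLaminar ((doubleLink H w).filter p) := fun p _ X hX Y hY =>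
      hlam w hwS X (Finset.mem_filter.1 hX).1 Y (Finset.mem_filter.1 hY).1
    have c1 : ((doubleLink H w).filter fun X => a ∈ X ∧ z ∈ X).card ≤ 2 := by
      refine (hlamf fun X => a ∈ X ∧ z ∈ X).card_le_two ?_ (a := a) (fun X hX => (Finset.mem_filter.1 hX).2.1)
      intro X hX Y hY T hT
      simp only [Finset.mem_filter] at hX hY hT
      exact hchain X hX.1 Y hY.1 T hT.1 ⟨a, hX.2.1⟩ (fun _ => hX.2.1) (fun _ => hX.2.2)
    have c2 : ((doubleLink H w).filter fun X => a ∈ X ∧ z ∉ X).card ≤ 2 := by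
      refine (hlamf fun X => a ∈ X ∧ z ∉ X).card_le_two ?_ (a := a) (fun X hX => (Finset.mem_filter.1 hX).2.1)
      intro X hX Y hY T hT
      simp only [Finset.mem_filter] at hX hY hT
      exact hchain X hX.1 Y hY.1 T hT.1 ⟨a, hX.2.1⟩ (fun _ => hX.2.1) (fun h => absurd h hT.2.2)
    have c3 : ((doubleLink H w).filter fun X => a ∉ X ∧ z ∈ X).card ≤ 2 := by
      refine (hlamf fun X => a ∉ X ∧ z ∈ X).card_le_two ?_ (a := z) (fun X hX => (Finset.mem_filter.1 hX).2.2)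
      intro X hX Y hY T hT
      simp only [Finset.mem_filter] at hX hY hT
      exact hchain X hX.1 Y hY.1 T hT.1 ⟨z, hX.2.2⟩ (fun h => absurd h hT.2.1) (fun _ => hX.2.2)
    obtain ⟨M, hM, hMc, hMd⟩ := (hlamf fun X => X.Nonempty ∧ a ∉ X ∧ z ∉ X).exists_pairwiseDisjoint
      (by
        intro X hX Y hY T hT
        simp only [Finset.mem_filter] at hX hY hT
        exact hchain X hX.1 Y hY.1 T hT.1 hX.2.1 (fun h => absurd h hT.2.2.1)
          (fun h => absurd h hT.2.2.2))
    refine ⟨M, hM.trans (Finset.filter_subset _ _), ?_, hMd, ?_⟩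
    -- At most seven members are lost: the empty set and two from each class containing `a` or `z`.
    -- At least 53 remain, and half of them are disjoint.
    · have hcover : doubleLink H w ⊆ {∅} ∪ ((doubleLink H w).filter fun X => a ∈ X ∧ z ∈ X) ∪
          ((doubleLink H w).filter fun X => a ∈ X ∧ z ∉ X) ∪
          ((doubleLink H w).filter fun X => a ∉ X ∧ z ∈ X) ∪
          ((doubleLink H w).filter fun X => X.Nonempty ∧ a ∉ X ∧ z ∉ X) := by
        intro X hX
        simp only [Finset.mem_union, Finset.mem_filter, Finset.mem_singleton,
          Finset.nonempty_iff_ne_empty]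
        tauto
      have h1 := Finset.card_le_card hcover
      have h2 := hbig w hwS
      have h3 := Finset.card_union_le ({∅} ∪ ((doubleLink H w).filter fun X => a ∈ X ∧ z ∈ X) ∪
          ((doubleLink H w).filter fun X => a ∈ X ∧ z ∉ X) ∪
          ((doubleLink H w).filter fun X => a ∉ X ∧ z ∈ X))
          ((doubleLink H w).filter fun X => X.Nonempty ∧ a ∉ X ∧ z ∉ X)
      have h4 := Finset.card_union_le ({∅} ∪ ((doubleLink H w).filter fun X => a ∈ X ∧ z ∈ X) ∪
          ((doubleLink H w).filter fun X => a ∈ X ∧ z ∉ X))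
          ((doubleLink H w).filter fun X => a ∉ X ∧ z ∈ X)
      have h5 := Finset.card_union_le ({∅} ∪ ((doubleLink H w).filter fun X => a ∈ X ∧ z ∈ X))
          ((doubleLink H w).filter fun X => a ∈ X ∧ z ∉ X)
      have h6 := Finset.card_union_le {∅} ((doubleLink H w).filter fun X => a ∈ X ∧ z ∈ X)
      rw [Finset.card_singleton] at h6
      omega
    · intro X hX
      have hX' := Finset.mem_filter.1 (hM hX)
      refine ⟨hX'.2.1, fun x hx => ?_⟩
      obtain ⟨k1, k2⟩ := hconf X hX'.1
      rw [Finset.mem_sdiff]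
      refine ⟨(Finset.mem_insert.1 (k1 hx)).resolve_left ?_, fun hxA => ?_⟩
      · rintro rfl
        exact hX'.2.2.2 hx
      · rcases k2 with h | h
        · exact hX'.2.2.1 (h ha)
        · exact Finset.disjoint_left.1 h hxA hx
  · refine ⟨S, hS0, fun w hw => ?_⟩
    obtain ⟨M, hM, hMc, hMd⟩ := IsLaminar.exists_pairwiseDisjoint
      (Q := (doubleLink H w).erase ∅)
      (fun X hX Y hY => hlam w hw X (Finset.mem_of_mem_erase hX) Y (Finset.mem_of_mem_erase hY))
      (by
        intro X hX Y hY T hT hXY hYT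
        rw [Finset.mem_erase] at hX hY hT
        refine hbox ⟨_, w, X, T, hX.2, hT.2, Finset.nonempty_iff_ne_empty.2 hX.1,
          hXY.1.trans hYT.1, ?_, rfl⟩
        rw [Finset.card_sdiff_of_subset (hXY.1.trans hYT.1)]
        have := Finset.card_lt_card hXY
        have := Finset.card_lt_card hYT
        omega)
    refine ⟨M, hM.trans (Finset.erase_subset _ _), ?_, hMd, ?_⟩
    · have := hbig w hw
      have := Finset.pred_card_le_card_erase (s := doubleLink H w) (a := ∅)
      omega
    · intro X hX
      have hX' := Finset.mem_erase.1 (hM hX)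
      exact ⟨Finset.nonempty_iff_ne_empty.2 hX'.1, hS X (mem_doubleLink.1 hX'.2).1⟩

/-- Two sparsely interacting families of disjoint sets contain five sets each that are disjoint
across the families. -/
lemma exists_cross_disjoint {M N : Finset (Finset α)} (hM : 20 ≤ M.card) (hN : 10 ≤ N.card)
    (hM0 : ∀ A ∈ M, A.Nonempty) (hNd : ∀ A ∈ N, ∀ B ∈ N, A ≠ B → Disjoint A B)
    (hsplit : ∀ B ∈ N, ∀ A ∈ M, ∀ A' ∈ M, ¬ Disjoint A B → ¬ A ⊆ B → ¬ Disjoint A' B →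
      ¬ A' ⊆ B → A = A') :
    ∃ f g : Fin 5 → Finset α, Function.Injective f ∧ Function.Injective g ∧ (∀ i, f i ∈ M) ∧
      (∀ i, g i ∈ N) ∧ ∀ i j, Disjoint (f i) (g j) := by
  obtain ⟨N₁, hN₁, hc₁⟩ := Finset.exists_subset_card_eq (show 5 ≤ N.card by omega)
  obtain ⟨N₂, hN₂, hc₂⟩ := Finset.exists_subset_card_eq (s := N \ N₁) (n := 5) (by
    rw [Finset.card_sdiff_of_subset hN₁]
    omega)
  have hdisj : Disjoint (M.filter fun A => ∃ B ∈ N₁, A ⊆ B)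
      (M.filter fun A => ∃ B ∈ N₂, A ⊆ B) := by
    rw [Finset.disjoint_left]
    intro A h1 h2
    rw [Finset.mem_filter] at h1 h2
    obtain ⟨hA, B, hB, hAB⟩ := h1
    obtain ⟨-, B', hB', hAB'⟩ := h2
    obtain ⟨a, ha⟩ := hM0 A hA
    have hB'' := Finset.mem_sdiff.1 (hN₂ hB')
    have hne : B ≠ B' := by
      rintro rfl
      exact hB''.2 hB
    exact Finset.disjoint_left.1 (hNd B (hN₁ hB) B' hB''.1 hne) (hAB ha) (hAB' ha)
  have hsum := Finset.card_union_of_disjoint hdisj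
  have hle := Finset.card_le_card (Finset.union_subset
    (Finset.filter_subset (fun A => ∃ B ∈ N₁, A ⊆ B) M)
    (Finset.filter_subset (fun A => ∃ B ∈ N₂, A ⊆ B) M))
  -- No member of `M` lies inside sets of both groups, so one group swallows at most half of `M`. Of
  -- the at least 10 others, at most 5 are split by the group, one per set.
  obtain ⟨N', hN', hc', hfew⟩ : ∃ N' ⊆ N, N'.card = 5 ∧
      2 * (M.filter fun A => ∃ B ∈ N', A ⊆ B).card ≤ M.card := by
    rcases le_total (M.filter fun A => ∃ B ∈ N₁, A ⊆ B).card
      (M.filter fun A => ∃ B ∈ N₂, A ⊆ B).card with h | h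
    · exact ⟨N₁, hN₁, hc₁, by omega⟩
    · exact ⟨N₂, hN₂.trans Finset.sdiff_subset, hc₂, by omega⟩
  have hbi : (N'.biUnion fun B => M.filter fun A => ¬ Disjoint A B ∧ ¬ A ⊆ B).card ≤ 5 := by
    refine (Finset.card_biUnion_le_card_mul N' _ 1 ?_).trans (by omega)
    intro B hB
    rw [Finset.card_le_one]
    intro A hA A' hA'
    rw [Finset.mem_filter] at hA hA'
    exact hsplit B (hN' hB) A hA.1 A' hA'.1 hA.2.1 hA.2.2 hA'.2.1 hA'.2.2
  obtain ⟨M', hM', hcM'⟩ := Finset.exists_subset_card_eq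
    (s := (M \ M.filter fun A => ∃ B ∈ N', A ⊆ B) \
      N'.biUnion fun B => M.filter fun A => ¬ Disjoint A B ∧ ¬ A ⊆ B) (n := 5) (by
      have h1 := Finset.le_card_sdiff (M.filter fun A => ∃ B ∈ N', A ⊆ B) M
      have h2 := Finset.le_card_sdiff
        (N'.biUnion fun B => M.filter fun A => ¬ Disjoint A B ∧ ¬ A ⊆ B)
        (M \ M.filter fun A => ∃ B ∈ N', A ⊆ B)
      omega)
  let f := (Finset.equivFinOfCardEq hcM').symm
  let g := (Finset.equivFinOfCardEq hc').symm
  have hf : ∀ i, (f i : Finset α) ∈ M ∧ ∀ B ∈ N', Disjoint (f i : Finset α) B := by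
    intro i
    have h := hM' (f i).2
    simp only [Finset.mem_sdiff, Finset.mem_filter, Finset.mem_biUnion, not_and, not_exists] at h
    refine ⟨h.1.1, fun B hB => ?_⟩
    by_contra hcon
    exact h.2 B hB h.1.1 hcon (h.1.2 h.1.1 B hB)
  exact ⟨fun i => f i, fun i => g i, Subtype.val_injective.comp f.injective,
    Subtype.val_injective.comp g.injective, fun i => (hf i).1, fun i => hN' (g i).2,
    fun i j => (hf i).2 _ (g j).2⟩

lemma card_filter_mem_le_one {N : Finset (Finset α)}
    (hN : ∀ A ∈ N, ∀ B ∈ N, A ≠ B → Disjoint A B) (w : α) :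
    (N.filter fun A => w ∈ A).card ≤ 1 := by
  rw [Finset.card_le_one]
  intro A hA B hB
  rw [Finset.mem_filter] at hA hB
  by_contra hAB
  exact Finset.disjoint_left.1 (hN A hA.1 B hB.1 hAB) hA.2 hB.2

lemma hasForks_pair {H : Finset (Finset α)} {w q : α} (hwq : w ≠ q) {f g : Fin 5 → Finset α}
    (hf : Function.Injective f) (hg : Function.Injective g)
    (hfH : ∀ i, insert w (f i) ∈ H) (hgH : ∀ i, insert q (g i) ∈ H)
    (hfd : ∀ i j, f i ≠ f j → Disjoint (f i) (f j)) (hgd : ∀ i j, g i ≠ g j → Disjoint (g i) (g j))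
    (hfg : ∀ i j, Disjoint (f i) (g j)) (hf0 : ∀ i, (f i).Nonempty) (hg0 : ∀ i, (g i).Nonempty)
    (hfwq : ∀ i, w ∉ f i ∧ q ∉ f i) (hgwq : ∀ i, w ∉ g i ∧ q ∉ g i) : HasForks H {w, q} := by
  have e1 : ∀ i, insert w (f i) \ {w, q} = f i := by
    intro i
    ext x
    have := hfwq i
    simp only [Finset.mem_sdiff, Finset.mem_insert, Finset.mem_singleton]
    grind
  have e2 : ∀ i, insert q (g i) \ {w, q} = g i := by
    intro i
    ext x
    have := hgwq i
    simp only [Finset.mem_sdiff, Finset.mem_insert, Finset.mem_singleton]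
    grind
  refine ⟨fun b => if b then {w} else {q}, fun b i => if b then insert w (f i) else insert q (g i),
    ?_, ?_, ?_, ?_, ?_⟩
  · intro b
    cases b <;> simp
  · simpa using hwq
  · ext x
    simp
  · intro b i
    cases b
    · simp only [Bool.false_eq_true, if_false, e2]
      refine ⟨hgH i, ?_, hg0 i⟩
      ext x
      have := hgwq i
      simp only [Finset.mem_inter, Finset.mem_insert, Finset.mem_singleton]
      grind
    · simp only [if_true, e1]
      refine ⟨hfH i, ?_, hf0 i⟩
      ext x
      have := hfwq i
      simp only [Finset.mem_inter, Finset.mem_insert, Finset.mem_singleton]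
      grind
  · intro b i c j hne
    cases b <;> cases c <;> simp only [Bool.false_eq_true, if_false, if_true, e1, e2]
    · exact hgd i j fun h => hne (by rw [hg h])
    · exact (hfg j i).symm
    · exact hfg i j
    · exact hfd i j fun h => hne (by rw [hf h])

/-- A smallest set `A` in a large disjoint subfamily of some link at `w` is a singleton `{q}`. The
links at `w` and `q` then supply the petals of `{w, q}`. -/
lemma RegionBound.exists_hasForks_of_doubleLinks [Fintype α] {H : Finset (Finset α)}
    (hH : RegionBound 4 H) {S : Finset α} (hS : ∀ A ∈ H, A ⊆ S) (hS0 : S.Nonempty)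
    (hbig : ∀ z ∈ S, 60 ≤ (doubleLink H z).card) : ∃ D ∈ H, HasForks H D := by
  obtain ⟨Z, ⟨w₀, hw₀⟩, hZ⟩ := hH.exists_disjoint_doubleLinks hS hS0 hbig
  -- The threshold is 21 rather than 22 because discarding the at most one set through `w` from the
  -- family at `q` must leave an admissible competitor.
  obtain ⟨n, ⟨w, M, A, hw, hM, hMc, hMd, hMZ, hA, rfl⟩, hmin⟩ :=
    WellFounded.has_min wellFounded_lt {n | ∃ w M A, w ∈ Z ∧ M ⊆ doubleLink H w ∧ 21 ≤ M.card ∧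
      (∀ A ∈ M, ∀ B ∈ M, A ≠ B → Disjoint A B) ∧ (∀ A ∈ M, A.Nonempty ∧ A ⊆ Z) ∧ A ∈ M ∧
      A.card = n} (by
        obtain ⟨M, hM, hMc, hMd, hMZ⟩ := hZ w₀ hw₀
        obtain ⟨A, hA⟩ := Finset.card_pos.1 (by omega : 0 < M.card)
        exact ⟨_, w₀, M, A, hw₀, hM, by omega, hMd, hMZ, hA, rfl⟩)
  have hwM : ∀ B ∈ M, B ∈ H ∧ w ∉ B ∧ insert w B ∈ H := fun B hB => mem_doubleLink.1 (hM hB)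
  obtain ⟨q, hq⟩ := (hMZ A hA).1
  have hqw : q ≠ w := by
    rintro rfl
    exact (hwM A hA).2.1 hq
  obtain ⟨N, hN, hNc, hNd, hNZ⟩ := hZ q ((hMZ A hA).2 hq)
  have hN' := card_filter_mem_le_one hNd w
  have hNsum := Finset.card_filter_add_card_filter_not (s := N) (fun B => w ∈ B)
  have hNmem : ∀ B ∈ N.filter fun B => w ∉ B, B ∈ N ∧ w ∉ B ∧ B ∈ H ∧ q ∉ B ∧ insert q B ∈ H := by
    intro B hB
    rw [Finset.mem_filter] at hB
    exact ⟨hB.1, hB.2, mem_doubleLink.1 (hN hB.1)⟩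
  have hA1 : A = {q} := by
    by_contra hne
    obtain ⟨u, hu, huq⟩ : ∃ u ∈ A, u ≠ q := by
      by_contra! hcon
      exact hne (Finset.eq_singleton_iff_unique_mem.2 ⟨hq, hcon⟩)
    -- A point `x` of `B` outside `A` and `w` would fill a fifth region: a lift of `B` separates `q`
    -- from `u` inside `A`, and `m`, `w` fill two more. So sets of `N` avoiding `w` lie in `A`
    -- without `q`, against minimality.
    have hsub : ∀ B ∈ N, ∀ x ∈ B, x ≠ w → x ∈ A := by
      intro B hB x hx hxw
      by_contra hxA
      have hcard : 1 < ((M.erase A).filter fun B => x ∉ B).card := by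
        have h1 := Finset.card_erase_of_mem hA
        have h2 := Finset.card_filter_add_card_filter_not (s := M.erase A) (fun B => x ∈ B)
        have h3 := card_filter_mem_le_one (N := M.erase A) (fun X hX Y hY =>
          hMd X (Finset.mem_of_mem_erase hX) Y (Finset.mem_of_mem_erase hY)) x
        omega
      obtain ⟨M₁, hM₁⟩ := Finset.card_pos.1 (by omega :
        0 < ((M.erase A).filter fun B => x ∉ B).card)
      rw [Finset.mem_filter, Finset.mem_erase] at hM₁
      obtain ⟨B', hB', hs, hBx⟩ := exists_separating_of_mem_doubleLink (hN hB) huq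
      obtain ⟨m, hm⟩ := (hMZ M₁ hM₁.1.2).1
      have hdisj := hMd A hA M₁ hM₁.1.2 (Ne.symm hM₁.1.1)
      have hmA : m ∉ A := fun h => Finset.disjoint_left.1 hdisj h hm
      have hqM : q ∉ M₁ := Finset.disjoint_left.1 hdisj hq
      have huM : u ∉ M₁ := Finset.disjoint_left.1 hdisj hu
      have hwA := (hwM A hA).2.1
      have hwM₁ := (hwM M₁ hM₁.1.2).2.1
      have huw : u ≠ w := by
        rintro rfl
        exact hwA hu
      have hmw : m ≠ w := by
        rintro rfl
        exact hwM₁ hm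
      have hxq : x ≠ q := by
        rintro rfl
        exact hxA hq
      have hxB : x ∈ B' := (hBx x hxq).2 hx
      refine hH.false_of_points (hwM A hA).2.2 (hwM M₁ hM₁.1.2).2.2 hB' [q, u, m, w, x]
        (by simp) ?_
      by_cases huB : u ∈ B' <;>
        simp [memPattern, hq, hu, hm, hmA, hqM, huM, hwA, hwM₁, huw, hmw, hqw, hxw, hxA, hxB,
          hM₁.2, hs, huB]
    obtain ⟨B, hB⟩ := Finset.card_pos.1 (by omega : 0 < (N.filter fun B => w ∉ B).card)
    refine hmin B.card ⟨q, N.filter fun B => w ∉ B, B, (hMZ A hA).2 hq,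
      (Finset.filter_subset _ _).trans hN, by omega, ?_, ?_, hB, rfl⟩ ?_
    · intro X hX Y hY
      exact hNd X (hNmem X hX).1 Y (hNmem Y hY).1
    · intro X hX
      exact hNZ X (hNmem X hX).1
    · apply Finset.card_lt_card
      rw [Finset.ssubset_iff_of_subset]
      · exact ⟨q, hq, (hNmem B hB).2.2.2.1⟩
      · intro x hx
        exact hsub B (hNmem B hB).1 x hx fun h => (hNmem B hB).2.1 (h ▸ hx)
  subst hA1
  have hMmem : ∀ B ∈ M.erase {q}, B ∈ M ∧ q ∉ B := by
    intro B hB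
    rw [Finset.mem_erase] at hB
    exact ⟨hB.2, by simpa using hMd _ hA _ hB.2 (Ne.symm hB.1)⟩
  obtain ⟨f, g, hf, hg, hfM, hgN, hfg⟩ := exists_cross_disjoint (M := M.erase {q})
    (N := N.filter fun B => w ∉ B) (by rw [Finset.card_erase_of_mem hA]; omega) (by omega)
    (fun B hB => (hMZ B (hMmem B hB).1).1)
    (fun X hX Y hY => hNd X (hNmem X hX).1 Y (hNmem Y hY).1) (by
      intro B hB X hX Y hY h1 h2 h3 h4
      by_contra hne
      obtain ⟨x, hxX, hxB⟩ := Finset.not_disjoint_iff.1 h1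
      obtain ⟨x', hxX', hxB'⟩ := Finset.not_subset.1 h2
      obtain ⟨y, hyY, hyB⟩ := Finset.not_disjoint_iff.1 h3
      obtain ⟨y', hyY', hyB'⟩ := Finset.not_subset.1 h4
      have hX' := hwM X (hMmem X hX).1
      have hY' := hwM Y (hMmem Y hY).1
      have hd := hMd X (hMmem X hX).1 Y (hMmem Y hY).1 hne
      have hxw : ∀ v ∈ X, v ≠ w := fun v hv h => hX'.2.1 (h ▸ hv)
      have hyw : ∀ v ∈ Y, v ≠ w := fun v hv h => hY'.2.1 (h ▸ hv)
      have hXY : ∀ v ∈ X, v ∉ Y := fun v hv => Finset.disjoint_left.1 hd hv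
      have hYX : ∀ v ∈ Y, v ∉ X := fun v hv => Finset.disjoint_right.1 hd hv
      -- If `B` splits both `X` and `Y`, their two halves fill four regions and `w`, common to both
      -- lifts, a fifth.
      refine hH.false_of_points hX'.2.2 hY'.2.2 (hNmem B hB).2.2.1 [x, x', y, y', w] (by simp) ?_
      simp [memPattern, hxX, hxB, hxX', hxB', hyY, hyB, hyY', hyB', hxw x hxX, hxw x' hxX',
        hyw y hyY, hyw y' hyY', hXY x hxX, hXY x' hxX', hYX y hyY, hYX y' hyY', (hNmem B hB).2.1])
  have hfM' := fun i => hwM _ (hMmem _ (hfM i)).1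
  have hgN' := fun i => hNmem _ (hgN i)
  refine ⟨{w, q}, (hwM {q} hA).2.2, hasForks_pair hqw.symm hf hg (fun i => (hfM' i).2.2)
    (fun i => (hgN' i).2.2.2.2) ?_ ?_ hfg (fun i => (hMZ _ (hMmem _ (hfM i)).1).1)
    (fun i => (hNZ _ (hgN' i).1).1) (fun i => ⟨(hfM' i).2.1, (hMmem _ (hfM i)).2⟩)
    (fun i => ⟨(hgN' i).2.1, (hgN' i).2.2.2.1⟩)⟩
  · exact fun i j => hMd _ (hMmem _ (hfM i)).1 _ (hMmem _ (hfM j)).1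
  · exact fun i j => hNd _ (hgN' i).1 _ (hgN' j).1

lemma subset_erase_of_mem_traceErase {H : Finset (Finset α)} {S : Finset α}
    (hS : ∀ A ∈ H, A ⊆ S) {z : α} : ∀ A ∈ traceErase H z, A ⊆ S.erase z := by
  intro A hA
  obtain ⟨B, hB, rfl⟩ := Finset.mem_image.1 hA
  exact Finset.erase_subset_erase _ (hS B hB)

omit [DecidableEq α] in
lemma card_le_one_of_subset_empty {H : Finset (Finset α)} (h : ∀ A ∈ H, A ⊆ ∅) : H.card ≤ 1 := by
  rw [Finset.card_le_one]
  intro A hA B hB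
  rw [Finset.subset_empty.1 (h A hA), Finset.subset_empty.1 (h B hB)]

lemma RegionBound.exists_hasForks [Fintype α] {n : ℕ} : ∀ {H : Finset (Finset α)} {S : Finset α},
    RegionBound 4 H → (∀ A ∈ H, A ⊆ S) → S.card = n → 60 * n + 1 < H.card →
    ∃ D ∈ H, HasForks H D := by
  induction n with
  | zero =>
    intro H S hH hS hn hc
    rw [Finset.card_eq_zero] at hn
    subst hn
    have := card_le_one_of_subset_empty hS
    omega
  | succ n ih =>
    intro H S hH hS hn hc
    by_cases hbig : ∀ z ∈ S, 60 ≤ (doubleLink H z).card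
    · exact hH.exists_hasForks_of_doubleLinks hS (Finset.card_pos.1 (by omega)) hbig
    · push Not at hbig
      obtain ⟨z, hz, hlt⟩ := hbig
      have hsum := card_traceErase_add_card_doubleLink H z
      obtain ⟨D, hD, hDf⟩ := ih (hH.trace z) (subset_erase_of_mem_traceErase hS (z := z))
        (by rw [Finset.card_erase_of_mem hz]; omega) (by omega)
      exact hDf.of_traceErase hH hD

/-- In a family with at most four filled regions per triple all but linearly many members have
forks. -/
lemma RegionBound.exists_forked_subfamily [Fintype α] {H : Finset (Finset α)} {S : Finset α}
    (hH : RegionBound 4 H) (hS : ∀ A ∈ H, A ⊆ S) :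
    ∃ H' ⊆ H, H.card ≤ H'.card + (60 * S.card + 1) ∧ ∀ D ∈ H', HasForks H D := by
  classical
  refine ⟨H.filter fun D => HasForks H D, Finset.filter_subset _ _, ?_, fun D hD =>
    (Finset.mem_filter.1 hD).2⟩
  have hsum := Finset.card_filter_add_card_filter_not (s := H) (fun D => HasForks H D)
  have hsub := Finset.filter_subset (fun D => ¬ HasForks H D) H
  by_contra! hcon
  obtain ⟨D, hD, hDf⟩ := (hH.mono hsub).exists_hasForks (fun A hA => hS A (hsub hA)) rfl
    (by omega)
  exact (Finset.mem_filter.1 hD).2 (hDf.mono hsub)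

end ForkExistence

/-! ### From forks to the quadratic and cubic bounds -/

section CubicBound

variable {α : Type*} [DecidableEq α]

lemma HasForks.exists_core_mem {H : Finset (Finset α)} {D : Finset α} (h : HasForks H D) {z : α}
    (hz : z ∈ D) : ∃ (P Q : Finset α) (B C : Fin 5 → Finset α), z ∈ P ∧ Q.Nonempty ∧
      Disjoint P Q ∧ D = P ∪ Q ∧
      (∀ i, B i ∈ H ∧ D ∩ B i = P ∧ (B i \ D).Nonempty) ∧
      (∀ i, C i ∈ H ∧ D ∩ C i = Q ∧ (C i \ D).Nonempty) ∧
      (∀ i j, i ≠ j → Disjoint (B i \ D) (B j \ D)) ∧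
      (∀ i j, i ≠ j → Disjoint (C i \ D) (C j \ D)) ∧
      ∀ i j, Disjoint (B i \ D) (C j \ D) := by
  obtain ⟨P, E, h1, h2, h3, h4, h5⟩ := h
  have hz' := hz
  rw [h3, Finset.mem_union] at hz'
  rcases hz' with hz' | hz'
  · exact ⟨P true, P false, E true, E false, hz', h1 _, h2, h3, h4 _, h4 _,
      fun i j hij => h5 _ _ _ _ (by simpa using hij), fun i j hij => h5 _ _ _ _ (by simpa using hij),
      fun i j => h5 _ _ _ _ (by simp)⟩
  · exact ⟨P false, P true, E false, E true, hz', h1 _, h2.symm, by rw [h3, Finset.union_comm],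
      h4 _, h4 _, fun i j hij => h5 _ _ _ _ (by simpa using hij),
      fun i j hij => h5 _ _ _ _ (by simpa using hij), fun i j => h5 _ _ _ _ (by simp)⟩

/-- Each of the four sets `β 0`, `γ 0`, `β 1`, `γ 1` lies in at most one `ε j`, so five petals leave
a good `j`. That `ε j` cannot lie in both of the disjoint unions `β 0 ∪ γ 0` and `β 1 ∪ γ 1`. -/
lemma exists_incomparable_petals {β γ ε : Fin 5 → Finset α} (hβ0 : ∀ i, (β i).Nonempty)
    (hγ0 : ∀ i, (γ i).Nonempty) (hε0 : ∀ i, (ε i).Nonempty)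
    (hβ : ∀ i j, i ≠ j → Disjoint (β i) (β j)) (hγ : ∀ i j, i ≠ j → Disjoint (γ i) (γ j))
    (hε : ∀ i j, i ≠ j → Disjoint (ε i) (ε j)) (hβγ : ∀ i j, Disjoint (β i) (γ j)) :
    ∃ i j, ¬ β i ⊆ ε j ∧ ¬ γ i ⊆ ε j ∧ ¬ ε j ⊆ β i ∪ γ i := by
  have hone : ∀ X : Finset α, X.Nonempty →
      (Finset.univ.filter fun j => X ⊆ ε j).card ≤ 1 := by
    rintro X ⟨x, hx⟩
    rw [Finset.card_le_one]
    intro i hi j hj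
    rw [Finset.mem_filter] at hi hj
    by_contra hij
    exact Finset.disjoint_left.1 (hε i j hij) (hi.2 hx) (hj.2 hx)
  obtain ⟨j, hj⟩ : ∃ j, ¬ (β 0 ⊆ ε j ∨ γ 0 ⊆ ε j ∨ β 1 ⊆ ε j ∨ γ 1 ⊆ ε j) := by
    by_contra! hcon
    have hcov : (Finset.univ : Finset (Fin 5)) ⊆ (Finset.univ.filter fun j => β 0 ⊆ ε j) ∪
        (Finset.univ.filter fun j => γ 0 ⊆ ε j) ∪ (Finset.univ.filter fun j => β 1 ⊆ ε j) ∪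
        (Finset.univ.filter fun j => γ 1 ⊆ ε j) := by
      intro j _
      have := hcon j
      simp only [Finset.mem_union, Finset.mem_filter, Finset.mem_univ, true_and]
      tauto
    have h1 := (Finset.card_le_card hcov).trans (Finset.card_union_le _ _)
    have h2 := Finset.card_union_le ((Finset.univ.filter fun j => β 0 ⊆ ε j) ∪
        (Finset.univ.filter fun j => γ 0 ⊆ ε j)) (Finset.univ.filter fun j => β 1 ⊆ ε j)
    have h3 := Finset.card_union_le (Finset.univ.filter fun j => β 0 ⊆ ε j)
        (Finset.univ.filter fun j => γ 0 ⊆ ε j)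
    have := hone _ (hβ0 0)
    have := hone _ (hγ0 0)
    have := hone _ (hβ0 1)
    have := hone _ (hγ0 1)
    simp only [Finset.card_univ, Fintype.card_fin] at h1
    omega
  push Not at hj
  by_cases h0 : ε j ⊆ β 0 ∪ γ 0
  · refine ⟨1, j, hj.2.2.1, hj.2.2.2, fun h1 => ?_⟩
    obtain ⟨x, hx⟩ := hε0 j
    have k0 := h0 hx
    have k1 := h1 hx
    rw [Finset.mem_union] at k0 k1
    rcases k0 with k0 | k0 <;> rcases k1 with k1 | k1
    · exact Finset.disjoint_left.1 (hβ 0 1 (by decide)) k0 k1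
    · exact Finset.disjoint_left.1 (hβγ 0 1) k0 k1
    · exact Finset.disjoint_left.1 (hβγ 1 0) k1 k0
    · exact Finset.disjoint_left.1 (hγ 0 1 (by decide)) k0 k1
  · exact ⟨0, j, hj.1, hj.2.1, h0⟩

/-- A set cannot have forks in two directions when no triple fills six inner regions. -/
lemma RegionBound.false_of_hasForks_of_hasForks [Fintype α] {G : Finset (Finset α)}
    (hG : RegionBound 5 G) {A : Finset α} {y z : α} (hyz : y ≠ z) (hy : y ∈ A) (hz : z ∈ A)
    (hAy : HasForks (doubleLink G y) (A.erase y)) (hAz : HasForks (doubleLink G z) (A.erase z)) :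
    False := by
  obtain ⟨P, Q, B, C, hzP, hQ0, hPQ, hD, hB, hC, hBB, hCC, hBC⟩ :=
    hAy.exists_core_mem (Finset.mem_erase.2 ⟨hyz.symm, hz⟩)
  obtain ⟨P', Q', B', C', hyP, -, hPQ', hD', hB', hC', hBB', hCC', -⟩ :=
    hAz.exists_core_mem (Finset.mem_erase.2 ⟨hyz, hy⟩)
  have hBH := fun i => mem_doubleLink.1 (hB i).1
  have hCH := fun i => mem_doubleLink.1 (hC i).1
  have hBH' := fun i => mem_doubleLink.1 (hB' i).1
  have hCH' := fun i => mem_doubleLink.1 (hC' i).1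
  have hBm : ∀ i x, x ∈ A → x ≠ y → (x ∈ B i ↔ x ∈ P) := by
    intro i x hx hxy
    rw [← (hB i).2.1]
    simp [hx, hxy]
  have hCm : ∀ i x, x ∈ A → x ≠ y → (x ∈ C i ↔ x ∈ Q) := by
    intro i x hx hxy
    rw [← (hC i).2.1]
    simp [hx, hxy]
  have hBm' : ∀ i x, x ∈ A → x ≠ z → (x ∈ B' i ↔ x ∈ P') := by
    intro i x hx hxy
    rw [← (hB' i).2.1]
    simp [hx, hxy]
  have hCm' : ∀ i x, x ∈ A → x ≠ z → (x ∈ C' i ↔ x ∈ Q') := by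
    intro i x hx hxy
    rw [← (hC' i).2.1]
    simp [hx, hxy]
  -- Each of the three sets gets a private point outside `A`, so three of the six regions are filled
  -- by petals alone.
  have hpriv : ∀ E' : Fin 5 → Finset α, (∀ j, z ∉ E' j) →
      (∀ j, (E' j \ A.erase z).Nonempty) →
      (∀ i j, i ≠ j → Disjoint (E' i \ A.erase z) (E' j \ A.erase z)) →
      ∃ i j, (∃ b ∉ A, b ∈ B i ∧ b ∉ C i ∧ b ∉ E' j) ∧ (∃ c ∉ A, c ∉ B i ∧ c ∈ C i ∧ c ∉ E' j) ∧
        ∃ e ∉ A, e ∉ B i ∧ e ∉ C i ∧ e ∈ E' j := by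
    intro E' hzE hE0 hEE
    obtain ⟨i, j, h1, h2, h3⟩ := exists_incomparable_petals (fun i => (hB i).2.2)
      (fun i => (hC i).2.2) hE0 hBB hCC hEE hBC
    have hdis := Finset.disjoint_left.1 (hBC i i)
    obtain ⟨b, hb, hb'⟩ := Finset.not_subset.1 h1
    obtain ⟨c, hc, hc'⟩ := Finset.not_subset.1 h2
    obtain ⟨e, he, he'⟩ := Finset.not_subset.1 h3
    have hyB := (hBH i).2.1
    have hyC := (hCH i).2.1
    have hzE' := hzE j
    refine ⟨i, j, ⟨b, ?_⟩, ⟨c, ?_⟩, ⟨e, ?_⟩⟩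
    · have := @hdis b
      simp only [Finset.mem_sdiff, Finset.mem_erase] at *
      grind
    · have := @hdis c
      simp only [Finset.mem_sdiff, Finset.mem_erase] at *
      grind
    · simp only [Finset.mem_union, Finset.mem_sdiff, Finset.mem_erase] at *
      grind
  have hne : ∀ x, x ∉ A → x ≠ y ∧ x ≠ z := by
    intro x hx
    constructor <;> rintro rfl <;> contradiction
  have hzQ : z ∉ Q := Finset.disjoint_left.1 hPQ hzP
  have hyQ : y ∉ Q' := Finset.disjoint_left.1 hPQ' hyP
  have hQA : ∀ x ∈ Q, x ∈ A ∧ x ≠ y ∧ x ≠ z := by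
    intro x hx
    have h1 : x ∈ A.erase y := by
      rw [hD]
      exact Finset.mem_union_right _ hx
    rw [Finset.mem_erase] at h1
    refine ⟨h1.2, h1.1, ?_⟩
    rintro rfl
    exact hzQ hx
  -- The third set, taken with `z`, must contain a point `p` of `Q`: use a petal set over `Q'` if
  -- `Q` meets `Q'`, otherwise one over `P'`. Then `y`, `z`, `p` fill the three remaining regions,
  -- wherever `y` lies in the third set.
  by_cases hQQ : ∃ p ∈ Q, p ∈ Q'
  · obtain ⟨p, hpQ, hpQ'⟩ := hQQ
    obtain ⟨i, j, ⟨b, hbA, hbB, hbC, hbE⟩, ⟨c, hcA, hcB, hcC, hcE⟩, ⟨e, heA, heB, heC, heE⟩⟩ :=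
      hpriv C' (fun j => (hCH' j).2.1) (fun j => (hC' j).2.2) hCC'
    have hpP : p ∉ P := Finset.disjoint_right.1 hPQ hpQ
    obtain ⟨hpA, hpy, hpz⟩ := hQA p hpQ
    refine hG.false_of_points (hBH i).2.2 (hCH i).2.2 (hCH' j).2.2 [y, z, p, b, c, e] (by simp) ?_
    simp [memPattern, hne b hbA, hne c hcA, hne e heA, hbB, hbC, hbE, hcB, hcC, hcE, heB, heC, heE,
      hyz, hyz.symm, hBm i p hpA hpy, hCm i p hpA hpy, hCm' j p hpA hpz, hBm i z hz hyz.symm,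
      hCm i z hz hyz.symm, hCm' j y hy hyz, hpP, hpQ, hpQ', hzP, hzQ, hyQ, hpy, hpz]
  · obtain ⟨p, hpQ⟩ := hQ0
    obtain ⟨i, j, ⟨b, hbA, hbB, hbC, hbE⟩, ⟨c, hcA, hcB, hcC, hcE⟩, ⟨e, heA, heB, heC, heE⟩⟩ :=
      hpriv B' (fun j => (hBH' j).2.1) (fun j => (hB' j).2.2) hBB'
    have hpP : p ∉ P := Finset.disjoint_right.1 hPQ hpQ
    obtain ⟨hpA, hpy, hpz⟩ := hQA p hpQ
    have hpP' : p ∈ P' := by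
      have h1 : p ∈ A.erase z := Finset.mem_erase.2 ⟨hpz, hpA⟩
      rw [hD', Finset.mem_union] at h1
      exact h1.resolve_right fun h => hQQ ⟨p, hpQ, h⟩
    refine hG.false_of_points (hBH i).2.2 (hCH i).2.2 (hBH' j).2.2 [y, z, p, b, c, e] (by simp) ?_
    simp [memPattern, hne b hbA, hne c hcA, hne e heA, hbB, hbC, hbE, hcB, hcC, hcE, heB, heC, heE,
      hyz, hyz.symm, hBm i p hpA hpy, hCm i p hpA hpy, hBm' j p hpA hpz, hBm i z hz hyz.symm,
      hCm i z hz hyz.symm, hBm' j y hy hyz, hpP, hpQ, hpP', hzP, hzQ, hyP, hpy, hpz]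

lemma subset_erase_of_mem_doubleLink {H : Finset (Finset α)} {S : Finset α}
    (hS : ∀ A ∈ H, A ⊆ S) {z : α} : ∀ A ∈ doubleLink H z, A ⊆ S.erase z := by
  intro A hA
  rw [mem_doubleLink] at hA
  exact Finset.subset_erase.2 ⟨hS A hA.1, hA.2.1⟩

lemma RegionBound.card_le_quadratic [Fintype α] {n : ℕ} :
    ∀ {G : Finset (Finset α)} {S : Finset α}, RegionBound 5 G → (∀ A ∈ G, A ⊆ S) → S.card = n →
      G.card ≤ 200 * n ^ 2 + 1 := by
  induction n with
  | zero =>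
    intro G S hG hS hn
    rw [Finset.card_eq_zero] at hn
    subst hn
    have := card_le_one_of_subset_empty hS
    omega
  | succ n ih =>
    intro G₀ S hG₀ hS₀ hn
    by_contra! hcon
    -- Trimming to the exact size keeps the number of sets below the number of pairs counted later.
    obtain ⟨G, hGG, hGc⟩ := Finset.exists_subset_card_eq
      (show 200 * (n + 1) ^ 2 + 2 ≤ G₀.card by omega)
    have hG := hG₀.mono hGG
    have hS : ∀ A ∈ G, A ⊆ S := fun A hA => hS₀ A (hGG hA)
    have hn0 : 1 ≤ n := by
      by_contra! hlt
      have hn1 : S.card = 1 := by omega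
      have h1 : G ⊆ S.powerset := fun A hA => Finset.mem_powerset.2 (hS A hA)
      have h2 := Finset.card_le_card h1
      rw [Finset.card_powerset, hn1] at h2
      have : 1 ≤ (n + 1) ^ 2 := Nat.one_le_pow _ _ (by omega)
      omega
    have hlink : ∀ y, RegionBound 4 (doubleLink G y) := fun y => hG.link (by norm_num) y
    choose L hLsub hLc hLf using fun y =>
      (hlink y).exists_forked_subfamily (subset_erase_of_mem_doubleLink hS (z := y))
    have hLbig : ∀ y ∈ S, 400 * n + 200 + 1 ≤ (L y).card + (60 * n + 1) := by
      intro y hy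
      have h1 := hLc y
      have h2 : (S.erase y).card = n := by
        rw [Finset.card_erase_of_mem hy]
        omega
      rw [h2] at h1
      have h3 := ih (hG.trace y) (subset_erase_of_mem_traceErase hS (z := y)) h2
      have h4 := card_traceErase_add_card_doubleLink G y
      have h5 : 200 * (n + 1) ^ 2 = 200 * n ^ 2 + 400 * n + 200 := by ring
      omega
    -- Every point has at least `340 * n + 200` forked link members; `n ≥ 1` is needed for their
    -- total to exceed `200 * (n + 1) ^ 2 + 2`.
    have hsum : G.card < (S.sigma L).card := by
      rw [Finset.card_sigma]
      have h1 : S.card • (340 * n + 200) ≤ ∑ y ∈ S, (L y).card :=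
        Finset.card_nsmul_le_sum _ _ _ fun y hy => by
          have := hLbig y hy
          omega
      rw [hn, smul_eq_mul] at h1
      nlinarith
    obtain ⟨⟨y, D⟩, hyD, ⟨z, E⟩, hzE, hne, heq⟩ :=
      Finset.exists_ne_map_eq_of_card_lt_of_maps_to hsum (f := fun p => insert p.1 p.2) (by
        rintro ⟨y, D⟩ hyD
        rw [Finset.mem_coe, Finset.mem_sigma] at hyD
        exact (mem_doubleLink.1 (hLsub y hyD.2)).2.2)
    rw [Finset.mem_sigma] at hyD hzE
    simp only at hyD hzE heq
    have hD := mem_doubleLink.1 (hLsub y hyD.2)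
    have hE := mem_doubleLink.1 (hLsub z hzE.2)
    have hDe : (insert y D).erase y = D := Finset.erase_insert hD.2.1
    have hEe : (insert z E).erase z = E := Finset.erase_insert hE.2.1
    by_cases hyz : y = z
    · subst hyz
      apply hne
      rw [← hDe, ← hEe, heq]
    · refine hG.false_of_hasForks_of_hasForks hyz (Finset.mem_insert_self y D)
        (heq ▸ Finset.mem_insert_self z E) ?_ ?_
      · rw [hDe]
        exact hLf y D hyD.2
      · rw [heq, hEe]
        exact hLf z E hzE.2

lemma RegionBound.card_le_cubic [Fintype α] {n : ℕ} :
    ∀ {F : Finset (Finset α)} {S : Finset α}, RegionBound 6 F → (∀ A ∈ F, A ⊆ S) → S.card = n →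
      F.card ≤ 201 * n ^ 3 + 1 := by
  induction n with
  | zero =>
    intro F S hF hS hn
    rw [Finset.card_eq_zero] at hn
    subst hn
    have := card_le_one_of_subset_empty hS
    omega
  | succ n ih =>
    intro F S hF hS hn
    obtain ⟨y, hy⟩ := Finset.card_pos.1 (by omega : 0 < S.card)
    have h2 : (S.erase y).card = n := by
      rw [Finset.card_erase_of_mem hy]
      omega
    have h3 := ih (hF.trace y) (subset_erase_of_mem_traceErase hS (z := y)) h2
    have h4 := (hF.link (by norm_num) y).card_le_quadratic
      (subset_erase_of_mem_doubleLink hS (z := y)) h2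
    have h5 := card_traceErase_add_card_doubleLink F y
    have h6 : 201 * (n + 1) ^ 3 = 201 * n ^ 3 + 603 * n ^ 2 + 603 * n + 201 := by ring
    nlinarith

end CubicBound

/-! ### Return to the Venn diagram -/

lemma innerRegionsFilled_of_card_filledRegions {n : ℕ} {A B C : Finset (Fin n)}
    (h : 6 < (filledRegions A B C).card) : InnerRegionsFilled A B C := by
  intro a b c hne
  have hsub : filledRegions A B C ⊆ Finset.univ.erase (false, false, false) := fun t ht =>
    Finset.mem_erase.2 ⟨(mem_filledRegions.1 ht).1, Finset.mem_univ _⟩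
  have heq := Finset.eq_of_subset_of_card_le hsub (by
    rw [Finset.card_erase_of_mem (Finset.mem_univ _)]
    simp
    omega)
  have hmem : (a, b, c) ∈ filledRegions A B C := by
    rw [heq]
    exact Finset.mem_erase.2 ⟨hne, Finset.mem_univ _⟩
  obtain ⟨-, x, hx⟩ := mem_filledRegions.1 hmem
  simp only [memPattern, Prod.mk.injEq] at hx
  refine ⟨x, ?_⟩
  obtain ⟨rfl, rfl, rfl⟩ := hx
  have hside : ∀ X : Finset (Fin n), x ∈ vennSide X (decide (x ∈ X)) := by
    intro X
    by_cases hX : x ∈ X <;> simp [vennSide, hX]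
  simp only [vennRegion, Finset.mem_inter]
  exact ⟨⟨hside A, hside B⟩, hside C⟩

theorem mainTheorem3 :
    ∃ K : ℝ, 0 < K ∧
      ∀ (n : ℕ), 1 ≤ n → ∀ F : Finset (Finset (Fin n)), K * (n : ℝ) ^ 3 ≤ (F.card : ℝ) →
        ∃ A ∈ F, ∃ B ∈ F, ∃ C ∈ F, InnerRegionsFilled A B C := by
  -- Any constant at least 203 beats `201 * n ^ 3 + 1` for `n ≥ 1`.
  refine ⟨203, by norm_num, fun n hn F hF => ?_⟩
  by_contra! hcon
  have hb : RegionBound 6 F := by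
    intro A hA B hB C hC
    by_contra! hlt
    exact hcon A hA B hB C hC (innerRegionsFilled_of_card_filledRegions hlt)
  have h1 := hb.card_le_cubic (S := Finset.univ) (fun A _ => Finset.subset_univ A) rfl
  rw [Finset.card_univ, Fintype.card_fin] at h1
  have h2 : 203 * n ^ 3 ≤ F.card := by exact_mod_cast hF
  have h3 : 1 ≤ n ^ 3 := Nat.one_le_pow _ _ hn
  omega
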